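/- All Banach spaces are real. A norm $\|\cdot\|$ on a space $E$ is called octahedral if for every finite-dimensional subspace $F\subseteq E$ and every $\varepsilon>0$ there is $y\in E$ with $\|y\|=1$ such that $\|x+y\|\ge(1-\varepsilon)(\|x\|+\|y\|)$ for all $x\in F$. A Banach space $X$ has the separable complementation property if every separable subspace $Y\subseteq X$ is contained in a separable subspace $Z\subseteq X$ that is complemented in $X$ (that is, the range of a bounded linear projection on $X$). $X$ is weakly countably determined if there is a sequence $(K_n)$ of weak$^*$-compact subsets of $X^{**}$ such that for all $x\in X$ and $u\in X^{**}\setminus X$ there is $n$ with $x\in K_n$ and $u\notin K_n$. Let $X$ be a Banach space. 1. If $X$ has the separable complementation property and contains a subspace isomorphic to $\ell_1$, then there is an equivalent norm on $X$ whose bidual norm on $X^{**}$ is octahedral. 2. If $X$ is weakly countably determined, then $X$ has the separable complementation property. Consequently, if $X$ is weakly countably determined and contains a subspace isomorphic to $\ell_1$, then there is an equivalent norm on $X$ whose bidual norm on $X^{**}$ is octahedral. -/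

import Mathlib

open scoped ENNReal

noncomputable section

namespace BidualOctahedral

/-- The real sequence space `ℓ₁` with its usual norm. -/
abbrev EllOne : Type := lp (fun _ : ℕ => ℝ) 1

/-- `X` contains an isomorphic copy of `ℓ₁`: some linear subspace of `X` is linearly homeomorphic
to `ℓ₁`. -/
def ContainsEllOne (X : Type*) [NormedAddCommGroup X] [NormedSpace ℝ X] : Prop :=
  ∃ Y : Submodule ℝ X, Nonempty (EllOne ≃L[ℝ] Y)

/-- The separable complementation property: every separable subspace is contained in a separable
subspace that is the range of a bounded linear projection of `X`. -/
def SeparableComplementation (X : Type*) [NormedAddCommGroup X] [NormedSpace ℝ X] : Prop :=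
  ∀ Y : Submodule ℝ X, TopologicalSpace.IsSeparable (Y : Set X) →
    ∃ Z : Submodule ℝ X, TopologicalSpace.IsSeparable (Z : Set X) ∧ Z.ClosedComplemented ∧ Y ≤ Z

/-- `X` is weakly countably determined: there are countably many weak-star compact subsets `K n` of
the bidual such that every point of (the canonical image of) `X` is separated from every point of
the bidual outside `X` by some `K n` containing the former but not the latter. -/
def WeaklyCountablyDetermined (X : Type*) [NormedAddCommGroup X] [NormedSpace ℝ X] : Prop :=
  ∃ K : ℕ → Set (WeakDual ℝ (StrongDual ℝ X)), (∀ n, IsCompact (K n)) ∧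
    ∀ (x : X) (u : StrongDual ℝ (StrongDual ℝ X)),
      u ∉ Set.range (NormedSpace.inclusionInDoubleDual ℝ X) →
      ∃ n, StrongDual.toWeakDual (NormedSpace.inclusionInDoubleDual ℝ X x) ∈ K n ∧
        StrongDual.toWeakDual u ∉ K n

/-- `p` is a norm on `X` equivalent to the given one (the lower bound makes the seminorm `p`
definite). -/
def IsEquivalentNorm {X : Type*} [NormedAddCommGroup X] [NormedSpace ℝ X]
    (p : Seminorm ℝ X) : Prop :=
  ∃ c C : ℝ, 0 < c ∧ 0 < C ∧ ∀ x : X, c * ‖x‖ ≤ p x ∧ p x ≤ C * ‖x‖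

/-- The dual norm `f ↦ sup {|f x| : p x ≤ 1}` of a norm `p`. It is only used for norms `p`
equivalent to the given norm, so the supremum is that of a nonempty bounded set. -/
def dualNorm {E : Type*} [NormedAddCommGroup E] [NormedSpace ℝ E] (p : E → ℝ) :
    StrongDual ℝ E → ℝ :=
  fun f => sSup {t : ℝ | ∃ x : E, p x ≤ 1 ∧ t = |f x|}

/-- The bidual norm of `p`, on the bidual of the space: the dual norm of the dual norm of `p`.
(Equivalent norms have the same continuous functionals, so the bidual is the same vector space.) -/
def bidualNorm {E : Type*} [NormedAddCommGroup E] [NormedSpace ℝ E] (p : E → ℝ) :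
    StrongDual ℝ (StrongDual ℝ E) → ℝ :=
  dualNorm (dualNorm p)

/-- The norm `q` on `E` is octahedral: for every finite-dimensional subspace `F` and every `ε > 0`
there is `y` with `q y = 1` and `q (x + y) ≥ (1 - ε) (q x + q y)` for all `x ∈ F`. -/
def IsOctahedral {E : Type*} [AddCommGroup E] [Module ℝ E] (q : E → ℝ) : Prop :=
  ∀ F : Submodule ℝ E, FiniteDimensional ℝ F → ∀ ε : ℝ, 0 < ε →
    ∃ y : E, q y = 1 ∧ ∀ x ∈ F, (1 - ε) * (q x + q y) ≤ q (x + y)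

/-- `X` has an equivalent norm whose bidual norm is octahedral. -/
def HasBidualOctahedralRenorming (X : Type*) [NormedAddCommGroup X] [NormedSpace ℝ X] : Prop :=
  ∃ p : Seminorm ℝ X, IsEquivalentNorm p ∧ IsOctahedral (bidualNorm p)

end BidualOctahedral

end

/-! ### Averaging operators for random signs with prescribed biases. -/

noncomputable section

namespace BidualOctahedral

/-! Renorming. Sign sequences act on a copy `Y` of ℓ₁ and extend to bounded functionals on `X`. Let
every coordinate carry a bias and, given the biases, draw the signs independently, each agreeing
with its bias with probability 3/4. The new norm is the distance to `Y` plus the largest expectation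
over all finitely additive laws of this kind. By Hahn–Banach a functional f in the dual ball is h +
ν, with h dominated by the distance to `Y` and ν such a law (`exists_decomposition`). Forcing the
n-th bias to be positive gives f_n, again in the dual ball, with value 1 at twice the n-th basis
vector of `Y`. The densities of these changes are bounded and orthogonal, so a sum of m differences
f_n - f has norm O(√m) (`IsInvariantMean.sum_coordOp_sub_le`), whence f_n → f weakly
(`eventually_sub_le_of_sqrt`). If u in the bidual nearly attains its norm at f, then u plus that
vector, evaluated at f_n, is nearly ‖u‖ + 1. This is octahedrality.

Complementation. A separable subspace is enlarged to a closed separable `Z`, together with a set `B`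
of functionals separating the points of `Z`, so that each x in `X` is approximated on finite subsets
of `B` by points of `Z` lying in any finitely many of the compact sets that contain x
(`exists_saturated`). A weak-star limit of such approximants lies in every compact set containing x,
hence in `X`, hence in `Z`, and agrees with x on `B`. So the annihilator of `B` in `X` is a
complement of `Z`. -/

/-- Configurations: every coordinate carries a bias (first component) and a sign (second one). -/
abbrev Config : Type := ℕ → Bool × Bool

/-- The real sign of a Boolean. -/
def sgn (b : Bool) : ℝ := if b then 1 else -1

/-- Boundedness of a real function on configurations. -/
def IsBdd (F : Config → ℝ) : Prop := ∃ C : ℝ, ∀ σ, |F σ| ≤ C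

/-- Change the bias of the coordinate `n` by `t` and draw its sign anew, in favour of the
bias with odds three to one; `coordOp n t F` is the expectation of `F` after this change. -/
def coordOp (n : ℕ) (t : Bool → Bool) : (Config → ℝ) →ₗ[ℝ] (Config → ℝ) where
  toFun F σ := 3 / 4 * F (Function.update σ n (t (σ n).1, t (σ n).1)) +
    1 / 4 * F (Function.update σ n (t (σ n).1, !(t (σ n).1)))
  map_add' F G := by
    funext σ
    simp only [Pi.add_apply]
    ring
  map_smul' c F := by
    funext σ
    simp only [Pi.smul_apply, smul_eq_mul, RingHom.id_apply]
    ring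

theorem coordOp_apply (n : ℕ) (t : Bool → Bool) (F : Config → ℝ) (σ : Config) :
    coordOp n t F σ = 3 / 4 * F (Function.update σ n (t (σ n).1, t (σ n).1)) +
      1 / 4 * F (Function.update σ n (t (σ n).1, !(t (σ n).1))) := rfl

theorem coordOp_le {n : ℕ} {t : Bool → Bool} {F : Config → ℝ} {c : ℝ} (h : ∀ σ, F σ ≤ c)
    (σ : Config) : coordOp n t F σ ≤ c := by
  rw [coordOp_apply]
  linarith [h (Function.update σ n (t (σ n).1, t (σ n).1)),
    h (Function.update σ n (t (σ n).1, !(t (σ n).1)))]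

theorem le_coordOp {n : ℕ} {t : Bool → Bool} {F : Config → ℝ} {c : ℝ} (h : ∀ σ, c ≤ F σ)
    (σ : Config) : c ≤ coordOp n t F σ := by
  rw [coordOp_apply]
  linarith [h (Function.update σ n (t (σ n).1, t (σ n).1)),
    h (Function.update σ n (t (σ n).1, !(t (σ n).1)))]

/-- A fresh draw forgets the previous sign, so only the two changes of bias compose; in particular
redrawing is idempotent. -/
theorem coordOp_comp (n : ℕ) (t u : Bool → Bool) (F : Config → ℝ) :
    coordOp n t (coordOp n u F) = coordOp n (u ∘ t) F := by
  funext σ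
  simp only [coordOp_apply, Function.update_self, Function.update_idem, Function.comp]
  ring

theorem coordOp_comm {n m : ℕ} (h : n ≠ m) (t u : Bool → Bool) (F : Config → ℝ) :
    coordOp n t (coordOp m u F) = coordOp m u (coordOp n t F) := by
  funext σ
  simp only [coordOp_apply, Function.update_of_ne h, Function.update_of_ne h.symm,
    Function.update_comm h]
  ring

namespace IsBdd

variable {F G : Config → ℝ}

theorem const (c : ℝ) : IsBdd (fun _ => c) := ⟨|c|, fun _ => le_rfl⟩

theorem add (hF : IsBdd F) (hG : IsBdd G) : IsBdd (F + G) := by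
  obtain ⟨C, hC⟩ := hF
  obtain ⟨D, hD⟩ := hG
  exact ⟨C + D, fun σ => (abs_add_le _ _).trans (add_le_add (hC σ) (hD σ))⟩

theorem mul (hF : IsBdd F) (hG : IsBdd G) : IsBdd (F * G) := by
  obtain ⟨C, hC⟩ := hF
  obtain ⟨D, hD⟩ := hG
  refine ⟨C * D, fun σ => ?_⟩
  rw [Pi.mul_apply, abs_mul]
  exact mul_le_mul (hC σ) (hD σ) (abs_nonneg _) ((abs_nonneg _).trans (hC σ))

theorem smul (c : ℝ) (hF : IsBdd F) : IsBdd (c • F) := by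
  obtain ⟨C, hC⟩ := hF
  refine ⟨|c| * C, fun σ => ?_⟩
  rw [Pi.smul_apply, smul_eq_mul, abs_mul]
  exact mul_le_mul_of_nonneg_left (hC σ) (abs_nonneg _)

theorem sub (hF : IsBdd F) (hG : IsBdd G) : IsBdd (F - G) := by
  have := hF.add (hG.smul (-1))
  rwa [neg_one_smul, ← sub_eq_add_neg] at this

theorem sum {ι : Type*} (J : Finset ι) {F : ι → Config → ℝ} (h : ∀ i ∈ J, IsBdd (F i)) :
    IsBdd (∑ i ∈ J, F i) := by
  classical
  induction J using Finset.induction_on with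
  | empty => exact Finset.sum_empty (M := Config → ℝ) ▸ const 0
  | insert i J hi ih =>
    rw [Finset.sum_insert hi]
    exact (h i (Finset.mem_insert_self i J)).add
      (ih fun j hj => h j (Finset.mem_insert_of_mem hj))

theorem coordOp (n : ℕ) (t : Bool → Bool) (hF : IsBdd F) :
    IsBdd (BidualOctahedral.coordOp n t F) := by
  obtain ⟨C, hC⟩ := hF
  exact ⟨C, fun σ => abs_le.2 ⟨le_coordOp (fun σ => (abs_le.1 (hC σ)).1) σ,
    coordOp_le (fun σ => (abs_le.1 (hC σ)).2) σ⟩⟩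

end IsBdd

/-- The space of bounded functions of the configuration. -/
def bddFun : Submodule ℝ (Config → ℝ) where
  carrier := {F | IsBdd F}
  add_mem' := IsBdd.add
  zero_mem' := IsBdd.const 0
  smul_mem' c _ := IsBdd.smul c

/-- Draw the signs of the coordinates below `N` anew. -/
def resample : ℕ → (Config → ℝ) →ₗ[ℝ] (Config → ℝ)
  | 0 => LinearMap.id
  | N + 1 => coordOp N id ∘ₗ resample N

theorem resample_succ (N : ℕ) (F : Config → ℝ) :
    resample (N + 1) F = coordOp N id (resample N F) := rfl

/-- Averaging preserves upper bounds. Hence two bounds found at different stages can be compared at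
the later one, which makes `upperExp` subadditive. -/
theorem resample_le_of_le {F : Config → ℝ} {c : ℝ} {N M : ℕ} (hNM : N ≤ M)
    (h : ∀ σ, resample N F σ ≤ c) : ∀ σ, resample M F σ ≤ c := by
  induction M, hNM using Nat.le_induction with
  | base => exact h
  | succ M _ ih => exact coordOp_le ih

theorem le_resample {F : Config → ℝ} {c : ℝ} (h : ∀ σ, c ≤ F σ) (N : ℕ) :
    ∀ σ, c ≤ resample N F σ := by
  induction N with
  | zero => exact h
  | succ N ih => exact le_coordOp ih

theorem resample_coordOp {N n : ℕ} (h : N ≤ n) (t : Bool → Bool) (F : Config → ℝ) :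
    resample N (coordOp n t F) = coordOp n t (resample N F) := by
  induction N with
  | zero => rfl
  | succ N ih =>
    rw [resample_succ, resample_succ, ih (by omega), coordOp_comm (by omega)]

theorem resample_succ_sub (n : ℕ) (F : Config → ℝ) :
    resample (n + 1) (F - coordOp n id F) = 0 := by
  rw [resample_succ, map_sub, map_sub, resample_coordOp le_rfl, coordOp_comp, Function.comp_id,
    sub_self]

/-! ### Upper expectation and the means it dominates. -/

/-- The upper expectation of a function of the configuration, over all distributions for which,
given the biases, the signs are independent and favour their bias with odds three to one. -/
def upperExp (F : Config → ℝ) : ℝ := sInf {c : ℝ | ∃ N, ∀ σ, resample N F σ ≤ c}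

theorem upperExp_bddBelow {F : Config → ℝ} (hF : IsBdd F) :
    BddBelow {c : ℝ | ∃ N, ∀ σ, resample N F σ ≤ c} := by
  obtain ⟨C, hC⟩ := hF
  refine ⟨-C, ?_⟩
  rintro c ⟨N, hN⟩
  exact (le_resample (fun σ => (abs_le.1 (hC σ)).1) N fun _ => (true, true)).trans (hN _)

theorem upperExp_le {F : Config → ℝ} (hF : IsBdd F) {c : ℝ} (N : ℕ)
    (h : ∀ σ, resample N F σ ≤ c) : upperExp F ≤ c :=
  csInf_le (upperExp_bddBelow hF) ⟨N, h⟩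

theorem le_upperExp {F : Config → ℝ} (hF : IsBdd F) {d : ℝ}
    (h : ∀ c N, (∀ σ, resample N F σ ≤ c) → d ≤ c) : d ≤ upperExp F := by
  obtain ⟨C, hC⟩ := hF
  refine le_csInf ⟨C, 0, fun σ => (abs_le.1 (hC σ)).2⟩ ?_
  rintro c ⟨N, hN⟩
  exact h c N hN

theorem upperExp_add_le {F G : Config → ℝ} (hF : IsBdd F) (hG : IsBdd G) :
    upperExp (F + G) ≤ upperExp F + upperExp G := by
  rw [← sub_le_iff_le_add']
  refine le_upperExp hG fun d M hM => ?_
  rw [sub_le_comm]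
  refine le_upperExp hF fun c N hN => ?_
  rw [sub_le_iff_le_add]
  refine upperExp_le (hF.add hG) (max N M) fun σ => ?_
  rw [map_add]
  exact add_le_add (resample_le_of_le (le_max_left N M) hN σ)
    (resample_le_of_le (le_max_right N M) hM σ)

theorem upperExp_smul_le {F : Config → ℝ} (hF : IsBdd F) {a : ℝ} (ha : 0 < a) :
    upperExp (a • F) ≤ a * upperExp F := by
  rw [← div_le_iff₀' ha]
  refine le_upperExp hF fun c N hN => ?_
  rw [div_le_iff₀' ha]
  refine upperExp_le (hF.smul a) N fun σ => ?_
  rw [map_smul]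
  exact mul_le_mul_of_nonneg_left (hN σ) ha.le

theorem upperExp_smul {F : Config → ℝ} (hF : IsBdd F) {a : ℝ} (ha : 0 < a) :
    upperExp (a • F) = a * upperExp F := by
  refine le_antisymm (upperExp_smul_le hF ha) ?_
  have h := upperExp_smul_le (hF.smul a) (inv_pos.2 ha)
  rw [inv_smul_smul₀ ha.ne'] at h
  rwa [← le_inv_mul_iff₀ ha]

theorem upperExp_nonneg_of_symm {F : Config → ℝ} (hF : IsBdd F)
    (h : upperExp (-F) = upperExp F) : 0 ≤ upperExp F := by
  have h1 := upperExp_add_le hF (hF.smul (-1))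
  rw [neg_one_smul, h, add_neg_cancel] at h1
  have h2 : (0 : ℝ) ≤ upperExp 0 := le_upperExp (IsBdd.const 0) fun c N hN => by
    exact (le_resample (fun _ => le_rfl) N _).trans (hN fun _ => (true, true))
  linarith

/-- Exchange all biases and all signs. -/
def flip (σ : Config) : Config := fun n => (!(σ n).1, !(σ n).2)

/-- Whether a sign agrees with its bias is unchanged when both are reversed, so the odds are
preserved. -/
theorem coordOp_comp_flip (n : ℕ) (F : Config → ℝ) :
    coordOp n id (F ∘ flip) = coordOp n id F ∘ flip := by
  have key : ∀ σ : Config, ∀ a b : Bool,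
      flip (Function.update σ n (a, b)) = Function.update (flip σ) n (!a, !b) := by
    intro σ a b
    funext k
    rcases eq_or_ne k n with rfl | h
    · simp [flip]
    · simp [flip, Function.update_of_ne h]
  funext σ
  simp only [coordOp_apply, Function.comp, key, id, flip]

theorem resample_comp_flip (N : ℕ) (F : Config → ℝ) :
    resample N (F ∘ flip) = resample N F ∘ flip := by
  induction N with
  | zero => rfl
  | succ N ih => rw [resample_succ, ih, coordOp_comp_flip, ← resample_succ]

theorem upperExp_comp_flip (F : Config → ℝ) : upperExp (F ∘ flip) = upperExp F := by
  have hs : ∀ σ, flip (flip σ) = σ := fun σ => by funext k; simp [flip]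
  unfold upperExp
  congr 1
  ext c
  simp only [Set.mem_ofPred_eq, resample_comp_flip, Function.comp]
  refine exists_congr fun N => ⟨fun h σ => ?_, fun h σ => h _⟩
  have := h (flip σ)
  rwa [hs] at this

/-- Means on bounded functions of the configuration under which, given the biases, the signs are
independent and favour their bias with odds three to one. -/
structure IsInvariantMean (ν : (Config → ℝ) →ₗ[ℝ] ℝ) : Prop where
  le_of_le : ∀ F, IsBdd F → ∀ c, (∀ σ, F σ ≤ c) → ν F ≤ c
  invariant : ∀ F, IsBdd F → ∀ n, ν (coordOp n id F) = ν F

theorem IsInvariantMean.le_upperExp {ν : (Config → ℝ) →ₗ[ℝ] ℝ} (hν : IsInvariantMean ν)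
    {F : Config → ℝ} (hF : IsBdd F) : ν F ≤ upperExp F := by
  have key : ∀ N, IsBdd (resample N F) ∧ ν (resample N F) = ν F := by
    intro N
    induction N with
    | zero => exact ⟨hF, rfl⟩
    | succ N ih =>
      rw [resample_succ]
      exact ⟨ih.1.coordOp N id, (hν.invariant _ ih.1 N).trans ih.2⟩
  refine BidualOctahedral.le_upperExp hF fun c N hN => ?_
  rw [← (key N).2]
  exact hν.le_of_le _ (key N).1 c hN

/-- Converse of `IsInvariantMean.le_upperExp`. The difference between a function and its redrawn
version is killed by `resample (n + 1)`, so its upper expectation is at most 0; applying this to the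
negative as well gives equality. -/
theorem isInvariantMean_of_le {ν : (Config → ℝ) →ₗ[ℝ] ℝ}
    (h : ∀ F, IsBdd F → ν F ≤ upperExp F) : IsInvariantMean ν where
  le_of_le F hF c hc := (h F hF).trans (upperExp_le hF 0 hc)
  invariant F hF n := by
    have key : ∀ G, IsBdd G → ν G ≤ ν (coordOp n id G) := by
      intro G hG
      have hb := hG.sub (hG.coordOp n id)
      have h1 := (h _ hb).trans (upperExp_le (c := 0) hb (n + 1) fun σ => by
        rw [resample_succ_sub]; rfl)
      rw [map_sub] at h1
      linarith
    refine le_antisymm ?_ (key F hF)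
    have h2 := key _ (hF.smul (-1))
    simp only [map_smul, smul_eq_mul] at h2
    linarith

namespace IsInvariantMean

variable {ν : (Config → ℝ) →ₗ[ℝ] ℝ}

theorem map_const (hν : IsInvariantMean ν) (c : ℝ) : ν (fun _ => c) = c := by
  refine le_antisymm (hν.le_of_le _ (IsBdd.const c) c fun _ => le_rfl) ?_
  have h := hν.le_of_le _ (IsBdd.const (-c)) (-c) fun _ => le_rfl
  have h2 : (fun _ : Config => -c) = -fun _ => c := rfl
  rw [h2, map_neg] at h
  linarith

/-- Forcing the bias of one coordinate leads to another invariant mean. -/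
theorem comp_coordOp (hν : IsInvariantMean ν) (n : ℕ) (b : Bool) :
    IsInvariantMean (ν ∘ₗ coordOp n fun _ => b) where
  le_of_le F hF c hc := hν.le_of_le _ (hF.coordOp n _) c (coordOp_le hc)
  invariant F hF k := by
    simp only [LinearMap.comp_apply]
    rcases eq_or_ne n k with rfl | h
    · rw [coordOp_comp, Function.id_comp]
    · rw [coordOp_comm h, hν.invariant _ (hF.coordOp n _)]

end IsInvariantMean

/-! ### Forcing a bias: orthogonality of the densities. -/

/-- The relative density of the change of mean that forces the bias of the coordinate `n` to be
positive. -/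
def forceDensity (n : ℕ) (σ : Config) : ℝ :=
  if (σ n).1 then 0 else if (σ n).2 then 2 else -2 / 3

theorem abs_forceDensity_le (n : ℕ) (σ : Config) : |forceDensity n σ| ≤ 2 := by
  unfold forceDensity
  split_ifs <;> norm_num [abs_le]

/-- Orthogonality: given the bias, `forceDensity n` has mean zero, and the other factor does not
involve coordinate `n`. -/
theorem coordOp_forceDensity_mul {n m : ℕ} (h : n ≠ m) :
    coordOp n id (forceDensity n * forceDensity m) = 0 := by
  funext σ
  simp only [coordOp_apply, Pi.mul_apply, forceDensity, Function.update_self, id,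
    Function.update_of_ne h.symm, Pi.zero_apply]
  cases (σ n).1
  · simp only [Bool.false_eq_true, if_false, Bool.not_false, if_true]
    ring
  · simp

/-- Turning a negative bias positive changes the weights of the two signs from 1/4, 3/4 to 3/4, 1/4.
The ratios 3 and 1/3, minus one, are the values 2 and -2/3 of `forceDensity`. The bias itself
changes too, so `F` must see only the signs. -/
theorem coordOp_true_eq {F : Config → ℝ} (hF : ∀ σ τ : Config, (∀ k, (σ k).2 = (τ k).2) →
    F σ = F τ) (n : ℕ) :
    coordOp n (fun _ => true) F = coordOp n id (F + F * forceDensity n) := by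
  have key : ∀ (σ : Config) (a b c : Bool), F (Function.update σ n (a, c)) =
      F (Function.update σ n (b, c)) := fun σ a b c => hF _ _ fun k => by
    rcases eq_or_ne k n with rfl | h
    · simp
    · simp [Function.update_of_ne h]
  funext σ
  simp only [coordOp_apply, Pi.add_apply, Pi.mul_apply, forceDensity, Function.update_self, id]
  cases (σ n).1
  · simp only [Bool.false_eq_true, if_false, Bool.not_false, Bool.not_true, if_true]
    rw [key σ true false true, key σ true false false]
    ring
  · simp

/-- Forcing many biases perturbs an invariant mean by a square-summable amount. -/
theorem IsInvariantMean.sum_coordOp_sub_le {ν : (Config → ℝ) →ₗ[ℝ] ℝ} (hν : IsInvariantMean ν)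
    {F : Config → ℝ} {B : ℝ} (hB : ∀ σ, |F σ| ≤ B)
    (hF : ∀ σ τ : Config, (∀ k, (σ k).2 = (τ k).2) → F σ = F τ) (J : Finset ℕ) :
    ∑ n ∈ J, (ν (coordOp n (fun _ => true) F) - ν F) ≤ √(J.card) * ((B ^ 2 + 4) / 2) := by
  have hFb : IsBdd F := ⟨B, hB⟩
  have hφ : ∀ n, IsBdd (forceDensity n) := fun n => ⟨2, abs_forceDensity_le n⟩
  set Ψ : Config → ℝ := ∑ n ∈ J, forceDensity n with hΨ
  have hΨb : IsBdd Ψ := IsBdd.sum J fun n _ => hφ n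
  have h1 : ∑ n ∈ J, (ν (coordOp n (fun _ => true) F) - ν F) = ν (F * Ψ) := by
    rw [hΨ, Finset.mul_sum, map_sum]
    refine Finset.sum_congr rfl fun n _ => ?_
    rw [coordOp_true_eq hF, hν.invariant _ (hFb.add (hFb.mul (hφ n))), map_add]
    ring
  have h2 : ν (Ψ * Ψ) ≤ J.card * 4 := by
    rw [hΨ, Finset.sum_mul_sum, map_sum]
    have : ∀ n ∈ J, ν (∑ m ∈ J, forceDensity n * forceDensity m) ≤ 4 := by
      intro n hn
      rw [map_sum, Finset.sum_eq_single n]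
      · refine hν.le_of_le _ ((hφ n).mul (hφ n)) 4 fun σ => ?_
        have := abs_forceDensity_le n σ
        rw [Pi.mul_apply, ← abs_mul_abs_self]
        nlinarith [abs_nonneg (forceDensity n σ)]
      · intro m _ hm
        rw [← hν.invariant _ ((hφ n).mul (hφ m)) n, coordOp_forceDensity_mul hm.symm, map_zero]
      · exact fun h => absurd hn h
    simpa using Finset.sum_le_sum this
  rw [h1]
  rcases J.eq_empty_or_nonempty with rfl | hJ
  · simp [hΨ]
  have hr : 0 < √(J.card : ℝ) := Real.sqrt_pos.2 (by exact_mod_cast hJ.card_pos)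
  have hrr : √(J.card : ℝ) * √(J.card : ℝ) = J.card := Real.mul_self_sqrt (Nat.cast_nonneg _)
  set r := √(J.card : ℝ)
  -- Pointwise AM–GM with weight `r = √(J.card)` replaces Cauchy–Schwarz for `ν`; this weight
  -- balances `r * B ^ 2 / 2` against the bound `2 * r` of `h7`.
  have h3 : ν (F * Ψ - (1 / (2 * r)) • (Ψ * Ψ)) ≤ r * B ^ 2 / 2 := by
    refine hν.le_of_le _ ((hFb.mul hΨb).sub ((hΨb.mul hΨb).smul _)) _ fun σ => ?_
    simp only [Pi.sub_apply, Pi.mul_apply, Pi.smul_apply, smul_eq_mul]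
    have h4 : F σ ^ 2 ≤ B ^ 2 := sq_le_sq' (abs_le.1 (hB σ)).1 (abs_le.1 (hB σ)).2
    have h5 : 0 ≤ (r * F σ - Ψ σ) ^ 2 / (2 * r) := by positivity
    have h6 : (r * F σ - Ψ σ) ^ 2 / (2 * r) =
        r * F σ ^ 2 / 2 - F σ * Ψ σ + 1 / (2 * r) * (Ψ σ * Ψ σ) := by
      field_simp
      ring
    nlinarith
  rw [map_sub, map_smul, smul_eq_mul] at h3
  have h7 : 1 / (2 * r) * ν (Ψ * Ψ) ≤ 2 * r := by
    rw [one_div, inv_mul_le_iff₀ (by positivity)]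
    nlinarith
  linarith

/-! ### Sign functionals and the equivalent norm. -/

theorem abs_sgn (b : Bool) : |sgn b| = 1 := by cases b <;> simp [sgn]

theorem sgn_not (b : Bool) : sgn (!b) = -sgn b := by cases b <;> simp [sgn]

theorem summable_abs_ellOne (c : EllOne) : Summable fun n => |c n| := by
  have h := (memℓp_gen_iff (p := 1) (by norm_num)).1 (lp.memℓp c)
  simpa using h

theorem norm_ellOne (c : EllOne) : ‖c‖ = ∑' n, |c n| := by
  rw [lp.norm_eq_tsum_rpow (by norm_num)]
  simp

theorem summable_mul_sgn (c : EllOne) (w : ℕ → Bool) : Summable fun n => c n * sgn (w n) := by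
  refine Summable.of_norm ?_
  simpa [abs_mul, abs_sgn] using summable_abs_ellOne c

/-- The functional on `ℓ₁` given by a sequence of signs. -/
def signFunctional (w : ℕ → Bool) : StrongDual ℝ EllOne :=
  LinearMap.mkContinuous
    { toFun := fun c => ∑' n, c n * sgn (w n)
      map_add' := fun c d => by
        rw [← (summable_mul_sgn c w).tsum_add (summable_mul_sgn d w)]
        simp [add_mul]
      map_smul' := fun a c => by
        simp [mul_assoc, tsum_mul_left] } 1 fun c => by
    have h := norm_tsum_le_tsum_norm (f := fun n => c n * sgn (w n))
      (by simpa [abs_mul, abs_sgn] using summable_abs_ellOne c)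
    simpa [abs_mul, abs_sgn, norm_ellOne] using h

theorem signFunctional_apply (w : ℕ → Bool) (c : EllOne) :
    signFunctional w c = ∑' n, c n * sgn (w n) := rfl

theorem norm_signFunctional_le (w : ℕ → Bool) : ‖signFunctional w‖ ≤ 1 :=
  LinearMap.mkContinuous_norm_le _ zero_le_one _

theorem signFunctional_not (w : ℕ → Bool) :
    signFunctional (fun n => !w n) = -signFunctional w := by
  ext c
  simp [signFunctional_apply, sgn_not, tsum_neg]

section Renorming

variable {X : Type*} [NormedAddCommGroup X] [NormedSpace ℝ X]

/-- The sign functionals on a copy of `ℓ₁` extend to a bounded odd family of functionals. -/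
theorem exists_sign_functionals {Y : Submodule ℝ X} (T : EllOne ≃L[ℝ] Y) :
    ∃ (M : ℝ) (g : (ℕ → Bool) → StrongDual ℝ X), 0 < M ∧ (∀ w, ‖g w‖ ≤ M) ∧
      (∀ w, g (fun n => !w n) = -g w) ∧
      ∀ w c, g w (T c) = ∑' n, c n * sgn (w n) := by
  have hext : ∀ w, ∃ f : StrongDual ℝ X, (∀ c, f (T c) = signFunctional w c) ∧
      ‖f‖ ≤ ‖(T.symm : Y →L[ℝ] EllOne)‖ := by
    intro w
    obtain ⟨f, hf, hn⟩ := exists_extension_norm_eq Y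
      ((signFunctional w).comp (T.symm : Y →L[ℝ] EllOne))
    refine ⟨f, fun c => by simp [hf], ?_⟩
    rw [hn]
    refine (ContinuousLinearMap.opNorm_comp_le _ _).trans ?_
    exact mul_le_of_le_one_left (norm_nonneg _) (norm_signFunctional_le w)
  choose f hf hn using hext
  -- Hahn–Banach extensions need not be odd in the signs; taking the odd part keeps the bound and
  -- the values on `Y`. Oddness makes the upper expectation symmetric.
  refine ⟨‖(T.symm : Y →L[ℝ] EllOne)‖ + 1,
    fun w => (1 / 2 : ℝ) • (f w - f fun n => !w n), by positivity, fun w => ?_, fun w => ?_,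
    fun w c => ?_⟩
  · rw [norm_smul]
    have h1 := norm_sub_le (f w) (f fun n => !w n)
    have h2 := hn w
    have h3 := hn fun n => !w n
    rw [Real.norm_of_nonneg (by norm_num)]
    linarith
  · simp only [Bool.not_not]
    exact (congrArg _ (neg_sub _ _).symm).trans (smul_neg _ _)
  · simp only [_root_.smul_apply, _root_.sub_apply, hf,
      signFunctional_not, _root_.neg_apply, smul_eq_mul]
    rw [signFunctional_apply]
    ring

/-- The values of a vector under a family of functionals indexed by signs. -/
def signMap (g : (ℕ → Bool) → StrongDual ℝ X) : X →ₗ[ℝ] (Config → ℝ) :=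
  LinearMap.pi fun σ => (g fun n => (σ n).2).toLinearMap

theorem signMap_apply (g : (ℕ → Bool) → StrongDual ℝ X) (x : X) (σ : Config) :
    signMap g x σ = g (fun n => (σ n).2) x := rfl

theorem signMap_congr (g : (ℕ → Bool) → StrongDual ℝ X) (x : X) (σ τ : Config)
    (h : ∀ k, (σ k).2 = (τ k).2) : signMap g x σ = signMap g x τ := by
  simp only [signMap_apply, h]

section

variable {g : (ℕ → Bool) → StrongDual ℝ X} {M : ℝ}

theorem abs_signMap_le (hM : ∀ w, ‖g w‖ ≤ M) (x : X) (σ : Config) :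
    |signMap g x σ| ≤ M * ‖x‖ :=
  ((g _).le_opNorm x).trans (mul_le_mul_of_nonneg_right (hM _) (norm_nonneg x))

theorem isBdd_signMap (hM : ∀ w, ‖g w‖ ≤ M) (x : X) : IsBdd (signMap g x) :=
  ⟨_, abs_signMap_le hM x⟩

theorem upperExp_signMap_le (hM : ∀ w, ‖g w‖ ≤ M) (x : X) :
    upperExp (signMap g x) ≤ M * ‖x‖ :=
  upperExp_le (isBdd_signMap hM x) 0 fun σ => (abs_le.1 (abs_signMap_le hM x σ)).2

theorem upperExp_signMap_neg (hodd : ∀ w, g (fun n => !w n) = -g w) (x : X) :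
    upperExp (signMap g (-x)) = upperExp (signMap g x) := by
  rw [← upperExp_comp_flip (signMap g x)]
  congr 1
  funext σ
  have : g (fun n => (flip σ n).2) = -g fun n => (σ n).2 := hodd _
  simp only [Function.comp, signMap_apply, this]
  simp

theorem upperExp_signMap_nonneg (hM : ∀ w, ‖g w‖ ≤ M) (hodd : ∀ w, g (fun n => !w n) = -g w)
    (x : X) : 0 ≤ upperExp (signMap g x) := by
  refine upperExp_nonneg_of_symm (isBdd_signMap hM x) ?_
  rw [← map_neg, upperExp_signMap_neg hodd]

theorem upperExp_signMap_smul (hM : ∀ w, ‖g w‖ ≤ M) (hodd : ∀ w, g (fun n => !w n) = -g w)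
    (a : ℝ) (x : X) : upperExp (signMap g (a • x)) = |a| * upperExp (signMap g x) := by
  have hpos : ∀ b : ℝ, 0 < b → upperExp (signMap g (b • x)) = b * upperExp (signMap g x) :=
    fun b hb => by rw [map_smul, upperExp_smul (isBdd_signMap hM x) hb]
  rcases lt_trichotomy a 0 with ha | rfl | ha
  · rw [← upperExp_signMap_neg hodd, ← neg_smul, hpos _ (neg_pos.2 ha), abs_of_neg ha]
  · rw [zero_smul, abs_zero, zero_mul]
    refine le_antisymm ?_ (upperExp_signMap_nonneg hM hodd 0)
    simpa using upperExp_signMap_le hM (0 : X)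
  · rw [hpos a ha, abs_of_pos ha]

/-- The sum of the distance to the subspace `Y` and of the upper expectation of the values under
the family `g`. -/
def signNorm (Y : Submodule ℝ X) (hM : ∀ w, ‖g w‖ ≤ M)
    (hodd : ∀ w, g (fun n => !w n) = -g w) : Seminorm ℝ X :=
  Seminorm.of (fun x => ‖Y.mkQ x‖ + upperExp (signMap g x))
    (fun x y => by
      have h := upperExp_add_le (isBdd_signMap hM x) (isBdd_signMap hM y)
      rw [map_add, map_add]
      linarith [norm_add_le (Y.mkQ x) (Y.mkQ y)])
    (fun a x => by
      rw [upperExp_signMap_smul hM hodd, map_smul, norm_smul, Real.norm_eq_abs, mul_add])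

theorem signNorm_apply (Y : Submodule ℝ X) (hM : ∀ w, ‖g w‖ ≤ M)
    (hodd : ∀ w, g (fun n => !w n) = -g w) (x : X) :
    signNorm Y hM hodd x = ‖Y.mkQ x‖ + upperExp (signMap g x) := rfl

theorem norm_mkQ_le (Y : Submodule ℝ X) (x : X) : ‖Y.mkQ x‖ ≤ ‖x‖ :=
  Submodule.Quotient.norm_mk_le Y x

theorem signNorm_le (Y : Submodule ℝ X) (hM : ∀ w, ‖g w‖ ≤ M)
    (hodd : ∀ w, g (fun n => !w n) = -g w) (x : X) :
    signNorm Y hM hodd x ≤ (1 + M) * ‖x‖ := by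
  rw [signNorm_apply]
  linarith [norm_mkQ_le Y x, upperExp_signMap_le hM x]

variable {Y : Submodule ℝ X} {T : EllOne ≃L[ℝ] Y}

theorem signMap_update (hg : ∀ w c, g w (T c) = ∑' n, c n * sgn (w n)) (c : EllOne)
    (σ : Config) (k : ℕ) (τ : Bool × Bool) :
    signMap g (T c) (Function.update σ k τ) =
      signMap g (T c) σ + c k * (sgn τ.2 - sgn (σ k).2) := by
  rw [signMap_apply, signMap_apply, hg, hg, ← sub_eq_iff_eq_add',
    ← (summable_mul_sgn c _).tsum_sub (summable_mul_sgn c _), tsum_eq_single k]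
  · rw [Function.update_self]
    ring
  · intro n hn
    rw [Function.update_of_ne hn, sub_self]

/-- On `Y` the values are linear in the signs, so redrawing replaces a sign by its mean, half the
sign of the bias. -/
theorem resample_signMap (hg : ∀ w c, g w (T c) = ∑' n, c n * sgn (w n)) (c : EllOne)
    (N : ℕ) (σ : Config) :
    resample N (signMap g (T c)) σ = signMap g (T c) σ +
      ∑ k ∈ Finset.range N, c k * (sgn (σ k).1 / 2 - sgn (σ k).2) := by
  induction N generalizing σ with
  | zero => simp [resample]
  | succ N ih =>
    rw [resample_succ, coordOp_apply, ih, ih, Finset.sum_range_succ]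
    have h : ∀ τ : Bool × Bool,
        ∑ k ∈ Finset.range N, c k * (sgn (Function.update σ N τ k).1 / 2 -
          sgn (Function.update σ N τ k).2) =
        ∑ k ∈ Finset.range N, c k * (sgn (σ k).1 / 2 - sgn (σ k).2) := fun τ =>
      Finset.sum_congr rfl fun k hk => by
        rw [Function.update_of_ne (Finset.mem_range.1 hk).ne]
    rw [h, h, signMap_update hg, signMap_update hg]
    simp only [id, sgn_not]
    ring

theorem norm_le_upperExp_signMap (hM : ∀ w, ‖g w‖ ≤ M)
    (hg : ∀ w c, g w (T c) = ∑' n, c n * sgn (w n)) (c : EllOne) :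
    ‖c‖ / 2 ≤ upperExp (signMap g (T c)) := by
  refine le_upperExp (isBdd_signMap hM _) fun d N hN => ?_
  -- Let biases and signs follow those of `c`: redrawing then loses only half of the first `N` terms
  -- of `∑ |c n|`.
  have h := hN fun n => (decide (0 ≤ c n), decide (0 ≤ c n))
  have hs : ∀ n, c n * sgn (decide (0 ≤ c n)) = |c n| := fun n => by
    by_cases hn : 0 ≤ c n
    · simp [sgn, hn, abs_of_nonneg hn]
    · simp [sgn, hn, abs_of_neg (not_le.1 hn)]
  have h1 : ∀ n, c n * (sgn (decide (0 ≤ c n)) / 2 - sgn (decide (0 ≤ c n))) = -(|c n| / 2) :=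
    fun n => by rw [← hs]; ring
  rw [resample_signMap hg, signMap_apply, hg] at h
  simp only [hs, h1] at h
  rw [Finset.sum_neg_distrib, ← Finset.sum_div] at h
  have h2 := (summable_abs_ellOne c).sum_le_tsum (Finset.range N) fun n _ => abs_nonneg (c n)
  rw [norm_ellOne]
  linarith

theorem isEquivalentNorm_signNorm (hM0 : 0 < M) (hM : ∀ w, ‖g w‖ ≤ M)
    (hodd : ∀ w, g (fun n => !w n) = -g w)
    (hg : ∀ w c, g w (T c) = ∑' n, c n * sgn (w n)) :
    IsEquivalentNorm (signNorm Y hM hodd) := by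
  set K : ℝ := ‖(T : EllOne →L[ℝ] Y)‖ + 1 with hK
  have hK1 : 0 < K := by positivity
  have key : ∀ x : X, ‖x‖ ≤ (2 * K * (1 + M) + 1) * signNorm Y hM hodd x := by
    intro x
    refine le_of_forall_pos_le_add fun δ hδ => ?_
    set ε : ℝ := δ / (2 * K * M + 1) with hε
    have hε0 : 0 < ε := by positivity
    -- An almost minimal representative `z` of the coset leaves `x - z` in `Y`, where the upper
    -- expectation controls the norm; `z` itself is controlled by the quotient norm.
    obtain ⟨z, hz, hzn⟩ := Submodule.Quotient.norm_mk_lt (S := Y) (Y.mkQ x) hε0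
    have hy : x - z ∈ Y := (Submodule.Quotient.eq Y).1 hz.symm
    obtain ⟨c, hc⟩ := T.surjective ⟨x - z, hy⟩
    have hc' : (T c : X) = x - z := by rw [hc]
    have h1 : ‖x - z‖ ≤ K * ‖c‖ := by
      rw [← hc']
      refine ((T : EllOne →L[ℝ] Y).le_opNorm c).trans ?_
      exact mul_le_mul_of_nonneg_right (by linarith) (norm_nonneg _)
    have h2 := norm_le_upperExp_signMap hM hg c
    have h3 := upperExp_add_le (isBdd_signMap hM x) (isBdd_signMap hM (-z))
    rw [← map_add, ← sub_eq_add_neg, ← hc', upperExp_signMap_neg hodd] at h3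
    have h4 := upperExp_signMap_le hM z
    have h5 : ‖x‖ ≤ ‖x - z‖ + ‖z‖ := by simpa using norm_add_le (x - z) z
    have h6 : (2 * K * M + 1) * ε = δ := by rw [hε]; field_simp
    have hQ := upperExp_signMap_nonneg hM hodd x
    have h7 : ‖x‖ ≤ 2 * K * upperExp (signMap g x) + (2 * K * M + 1) * ‖z‖ := by nlinarith
    have h8 : (2 * K * M + 1) * ‖z‖ ≤ (2 * K * M + 1) * (‖Y.mkQ x‖ + ε) :=
      mul_le_mul_of_nonneg_left hzn.le (by positivity)
    rw [signNorm_apply]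
    have h9 : 0 ≤ (2 * K * M + 1) * upperExp (signMap g x) := by positivity
    have h10 : 0 ≤ 2 * K * ‖Y.mkQ x‖ := by positivity
    nlinarith
  refine ⟨(2 * K * (1 + M) + 1)⁻¹, 1 + M, by positivity, by positivity, fun x =>
    ⟨?_, signNorm_le Y hM hodd x⟩⟩
  rw [inv_mul_le_iff₀ (by positivity)]
  exact key x

/-- A functional bounded by the norm `signNorm` splits into one that is bounded by the distance
to `Y` and one that is represented by an invariant mean. -/
theorem exists_decomposition (hM : ∀ w, ‖g w‖ ≤ M)
    (hodd : ∀ w, g (fun n => !w n) = -g w) (f : X →ₗ[ℝ] ℝ)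
    (hf : ∀ x, f x ≤ signNorm Y hM hodd x) :
    ∃ (h : X →ₗ[ℝ] ℝ) (ν : (Config → ℝ) →ₗ[ℝ] ℝ), (∀ x, h x ≤ ‖Y.mkQ x‖) ∧
      IsInvariantMean ν ∧ ∀ x, f x = h x + ν (signMap g x) := by
  -- Hahn–Banach in the product, starting from `f` on the graph of `signMap g`: restricting the
  -- extension to the two factors splits `f`.
  let Φ : X →ₗ[ℝ] X × bddFun :=
    LinearMap.id.prod ((signMap g).codRestrict bddFun fun x => isBdd_signMap hM x)
  have hΦ : ∀ z : LinearMap.range Φ, Φ (z : X × bddFun).1 = z := by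
    rintro ⟨_, x, rfl⟩
    rfl
  let F : X × bddFun →ₗ.[ℝ] ℝ :=
    { domain := LinearMap.range Φ
      toFun := f ∘ₗ LinearMap.fst ℝ X bddFun ∘ₗ (LinearMap.range Φ).subtype }
  obtain ⟨G, hG, hGN⟩ := exists_extension_of_le_sublinear F
    (fun z => ‖Y.mkQ z.1‖ + upperExp z.2)
    (fun a ha z => by
      have h1 : upperExp ((a • z).2 : bddFun) = a * upperExp z.2 := upperExp_smul z.2.2 ha
      rw [h1, Prod.smul_fst, map_smul, norm_smul, Real.norm_of_nonneg ha.le, mul_add])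
    (fun z w => by
      have h1 : upperExp ((z + w).2 : bddFun) ≤ upperExp z.2 + upperExp w.2 :=
        upperExp_add_le z.2.2 w.2.2
      rw [Prod.fst_add, map_add]
      linarith [norm_add_le (Y.mkQ z.1) (Y.mkQ w.1)])
    (fun z => by
      have h1 := hf (z : X × bddFun).1
      rw [signNorm_apply] at h1
      have h2 : ((z : X × bddFun).2 : Config → ℝ) = signMap g (z : X × bddFun).1 :=
        (congrArg (fun q : X × bddFun => (q.2 : Config → ℝ)) (hΦ z)).symm
      rw [h2]
      exact h1)
  -- The values on unbounded functions are arbitrary and play no role.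
  obtain ⟨ν, hν⟩ := LinearMap.exists_extend (G ∘ₗ LinearMap.inr ℝ X bddFun)
  have hν' : ∀ H : bddFun, ν H = G (0, H) := fun H => LinearMap.congr_fun hν H
  have hz : upperExp 0 ≤ 0 := upperExp_le (IsBdd.const 0) 0 fun _ => le_rfl
  refine ⟨G ∘ₗ LinearMap.inl ℝ X bddFun, ν, fun x => ?_, ?_, fun x => ?_⟩
  · have h1 := hGN (x, 0)
    have h2 : upperExp ((0 : bddFun) : Config → ℝ) ≤ 0 := hz
    simp only [LinearMap.comp_apply, LinearMap.inl_apply]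
    linarith
  · refine isInvariantMean_of_le fun H hH => ?_
    have h1 := hGN (0, ⟨H, hH⟩)
    rw [hν' ⟨H, hH⟩]
    simpa using h1
  · have h1 := hG ⟨Φ x, x, rfl⟩
    have h2 : ν (signMap g x) = G (0, ⟨signMap g x, isBdd_signMap hM x⟩) :=
      hν' ⟨signMap g x, isBdd_signMap hM x⟩
    rw [h2, LinearMap.comp_apply, LinearMap.inl_apply, ← map_add, Prod.mk_add_mk, add_zero,
      zero_add]
    exact h1.symm

end

/-! ### Weak convergence and asymptotic directions. -/

/-- If finitely many terms of a sequence of functionals have sums of deviations of the order of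
the square root of their number, then the sequence converges weakly. -/
theorem eventually_sub_le_of_sqrt {f : StrongDual ℝ X} {φ : ℕ → StrongDual ℝ X} {K : ℝ}
    (hK : ∀ (J : Finset ℕ) (x : X), ‖x‖ = 1 → ∑ n ∈ J, (φ n x - f x) ≤ √(J.card) * K)
    (u : StrongDual ℝ (StrongDual ℝ X)) {δ : ℝ} (hδ : 0 < δ) :
    ∀ᶠ n in Filter.atTop, u f - δ ≤ u (φ n) := by
  have hfin : {n | u (φ n) < u f - δ}.Finite := by
    by_contra hinf
    -- With `m` bad indices, `u` applied to the sum of the differences is at least `m * δ` but at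
    -- most `‖u‖ * √m * |K|`, which fails for this `m`.
    obtain ⟨m, hm⟩ := exists_nat_gt ((‖u‖ * |K| / δ) ^ 2)
    obtain ⟨J, hJ, hcard⟩ := Set.Infinite.exists_subset_card_eq hinf m
    have h1 : ‖∑ n ∈ J, (f - φ n)‖ ≤ √(m : ℝ) * |K| := by
      refine ContinuousLinearMap.opNorm_le_of_unit_norm (by positivity) fun x hx => ?_
      have hle : ∀ x : X, ‖x‖ = 1 → -(√(m : ℝ) * |K|) ≤ (∑ n ∈ J, (f - φ n)) x := by
        intro x hx
        have h2 := hK J x hx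
        have h3 : √(J.card : ℝ) * K ≤ √(m : ℝ) * |K| := by
          rw [hcard]
          exact mul_le_mul_of_nonneg_left (le_abs_self K) (Real.sqrt_nonneg _)
        have h4 : (∑ n ∈ J, (f - φ n)) x = -∑ n ∈ J, (φ n x - f x) := by
          rw [_root_.sum_apply, ← Finset.sum_neg_distrib]
          simp
        linarith
      rw [Real.norm_eq_abs, abs_le]
      refine ⟨hle x hx, ?_⟩
      have := hle (-x) (by rwa [norm_neg])
      rw [map_neg] at this
      linarith
    have h2 : (m : ℝ) * δ ≤ u (∑ n ∈ J, (f - φ n)) := by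
      rw [map_sum, ← hcard, ← nsmul_eq_mul]
      refine Finset.card_nsmul_le_sum J _ _ fun n hn => ?_
      have : u (φ n) < u f - δ := hJ hn
      rw [map_sub]
      linarith
    have h3 : u (∑ n ∈ J, (f - φ n)) ≤ ‖u‖ * (√(m : ℝ) * |K|) :=
      (le_abs_self _).trans ((u.le_opNorm _).trans
        (mul_le_mul_of_nonneg_left h1 (norm_nonneg _)))
    have h4 : ‖u‖ * |K| / δ < √(m : ℝ) := Real.lt_sqrt_of_sq_lt hm
    rw [div_lt_iff₀ hδ] at h4
    have h5 : 0 < √(m : ℝ) := lt_of_le_of_lt (by positivity) (Real.lt_sqrt_of_sq_lt hm)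
    have h6 := Real.mul_self_sqrt (Nat.cast_nonneg (α := ℝ) m)
    nlinarith
  rw [← Nat.cofinite_eq_atTop]
  filter_upwards [hfin.compl_mem_cofinite] with n hn
  simpa using hn

/-- A space containing `ℓ₁` has an equivalent norm and a sequence of vectors of norm at most one
such that every functional of norm one is a weak limit of functionals of norm one that take the
value one at these vectors. -/
theorem exists_norm_with_asymptotic_directions (hX : ContainsEllOne X) :
    ∃ (p : Seminorm ℝ X) (y : ℕ → X), IsEquivalentNorm p ∧ (∀ n, p (y n) ≤ 1) ∧
      ∀ f : StrongDual ℝ X, (∀ x, |f x| ≤ p x) → ∃ φ : ℕ → StrongDual ℝ X,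
        (∀ n x, |φ n x| ≤ p x) ∧ (∀ n, φ n (y n) = 1) ∧
        ∀ (u : StrongDual ℝ (StrongDual ℝ X)) (δ : ℝ), 0 < δ →
          ∀ᶠ n in Filter.atTop, u f - δ ≤ u (φ n) := by
  obtain ⟨Y, ⟨T⟩⟩ := hX
  obtain ⟨M, g, hM0, hM, hodd, hg⟩ := exists_sign_functionals T
  set p := signNorm Y hM hodd with hp
  let e : ℕ → X := fun n => T (lp.single 1 n (1 : ℝ))
  have heY : ∀ n, Y.mkQ (e n) = 0 := fun n =>
    (Submodule.Quotient.mk_eq_zero Y).2 (T (lp.single 1 n (1 : ℝ))).2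
  have he : ∀ n, signMap g (e n) = fun σ => sgn (σ n).2 := by
    intro n
    funext σ
    rw [signMap_apply, hg, tsum_eq_single n]
    · simp
    · intro k hk
      simp [hk]
  have hcoord : ∀ n t σ, coordOp n t (signMap g (e n)) σ = sgn (t (σ n).1) / 2 := by
    intro n t σ
    rw [he, coordOp_apply]
    simp only [Function.update_self, sgn_not]
    ring
  -- The factor 2 compensates for the mean ±1/2 of a biased sign.
  refine ⟨p, fun n => (2 : ℝ) • e n, isEquivalentNorm_signNorm hM0 hM hodd hg, fun n => ?_,
    fun f hf => ?_⟩
  · have h1 : upperExp (signMap g (e n)) ≤ 1 / 2 := by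
      refine upperExp_le (isBdd_signMap hM _) (n + 1) fun σ => ?_
      have h2 : resample (n + 1) (signMap g (e n)) =
          resample (n + 1) (coordOp n id (signMap g (e n))) := by
        rw [← sub_eq_zero, ← map_sub, resample_succ_sub]
      have h3 : ∀ σ, resample 0 (coordOp n id (signMap g (e n))) σ ≤ 1 / 2 := fun σ => by
        change coordOp n id (signMap g (e n)) σ ≤ 1 / 2
        rw [hcoord]
        linarith [le_abs_self (sgn (id (σ n).1)), abs_sgn (id (σ n).1)]
      rw [h2]
      exact resample_le_of_le (Nat.zero_le _) h3 σ
    rw [map_smul_eq_mul, hp, signNorm_apply, heY, norm_zero, Real.norm_of_nonneg (by norm_num)]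
    linarith
  obtain ⟨h, ν, hh, hν, hfν⟩ := exists_decomposition hM hodd f.toLinearMap
    fun x => (le_abs_self _).trans (hf x)
  let ψ : ℕ → X →ₗ[ℝ] ℝ := fun n => h + ν ∘ₗ coordOp n (fun _ => true) ∘ₗ signMap g
  have hψ : ∀ n x, ψ n x = h x + ν (coordOp n (fun _ => true) (signMap g x)) := fun _ _ => rfl
  have hψle : ∀ n x, ψ n x ≤ p x := by
    intro n x
    have := (hν.comp_coordOp n true).le_upperExp (isBdd_signMap hM x)
    rw [LinearMap.comp_apply] at this
    rw [hψ, hp, signNorm_apply]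
    linarith [hh x]
  have hψabs : ∀ n x, |ψ n x| ≤ p x := by
    intro n x
    refine abs_le'.2 ⟨hψle n x, ?_⟩
    have := hψle n (-x)
    rwa [map_neg, map_neg_eq_map] at this
  refine ⟨fun n => (ψ n).mkContinuous (1 + M) fun x =>
    (hψabs n x).trans (signNorm_le Y hM hodd x), hψabs, fun n => ?_, fun u δ hδ => ?_⟩
  · have h1 : h (e n) = 0 := by
      have h2 := hh (e n)
      have h3 := hh (-e n)
      rw [map_neg, map_neg, norm_neg] at h3
      rw [heY, norm_zero] at h2 h3
      linarith
    have h2 : coordOp n (fun _ => true) (signMap g (e n)) = fun _ => 1 / 2 := by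
      funext σ
      rw [hcoord]
      simp [sgn]
    rw [LinearMap.mkContinuous_apply, map_smul, hψ, h1, h2, hν.map_const]
    norm_num
  · refine eventually_sub_le_of_sqrt (K := (M ^ 2 + 4) / 2) (fun J x hx => ?_) u hδ
    have h1 := hν.sum_coordOp_sub_le (abs_signMap_le hM x) (signMap_congr g x) J
    rw [hx, mul_one] at h1
    refine le_trans (le_of_eq ?_) h1
    refine Finset.sum_congr rfl fun n _ => ?_
    have h2 : f x = h x + ν (signMap g x) := hfν x
    rw [LinearMap.mkContinuous_apply, hψ, h2]
    ring

end Renorming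

/-! ### The bidual norm and octahedrality. -/

section BidualNorm

variable {X : Type*} [NormedAddCommGroup X] [NormedSpace ℝ X] {p : Seminorm ℝ X}

namespace IsEquivalentNorm

/-- The dual unit ball of an equivalent norm consists of the functionals dominated by it. -/
theorem dualNorm_le_one_iff (hp : IsEquivalentNorm p) (f : StrongDual ℝ X) :
    dualNorm p f ≤ 1 ↔ ∀ x, |f x| ≤ p x := by
  obtain ⟨c, C, hc, hC, h⟩ := hp
  have hle : ∀ x, p x ≤ 1 → ‖x‖ ≤ c⁻¹ := fun x hx => by
    rw [← mul_one c⁻¹, le_inv_mul_iff₀ hc]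
    exact (h x).1.trans hx
  have hbdd : BddAbove {t : ℝ | ∃ x : X, p x ≤ 1 ∧ t = |f x|} := by
    refine ⟨‖f‖ * c⁻¹, ?_⟩
    rintro t ⟨x, hx, rfl⟩
    exact (f.le_opNorm x).trans (mul_le_mul_of_nonneg_left (hle x hx) (norm_nonneg f))
  constructor
  · intro hf x
    rcases (apply_nonneg p x).eq_or_lt with h0 | h0
    · have : x = 0 := norm_le_zero_iff.1 (by
        have := (h x).1
        rw [← h0] at this
        exact nonpos_of_mul_nonpos_right this hc)
      simp [this]
    · have h1 : |f ((p x)⁻¹ • x)| ≤ dualNorm p f := by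
        refine le_csSup hbdd ⟨_, ?_, rfl⟩
        rw [map_smul_eq_mul, Real.norm_of_nonneg (inv_nonneg.2 h0.le), inv_mul_cancel₀ h0.ne']
      have h2 := h1.trans hf
      rw [map_smul, smul_eq_mul, abs_mul, abs_of_pos (inv_pos.2 h0), inv_mul_le_iff₀ h0,
        mul_one] at h2
      exact h2
  · intro hf
    refine csSup_le ⟨_, 0, by simp, rfl⟩ ?_
    rintro t ⟨x, hx, rfl⟩
    exact (hf x).trans hx

theorem exists_opNorm_le (hp : IsEquivalentNorm p) :
    ∃ C : ℝ, 0 < C ∧ ∀ f : StrongDual ℝ X, (∀ x, |f x| ≤ p x) → ‖f‖ ≤ C := by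
  obtain ⟨c, C, hc, hC, h⟩ := hp
  exact ⟨C, hC, fun f hf => f.opNorm_le_bound hC.le fun x => (hf x).trans (h x).2⟩

theorem abs_le_bidualNorm (hp : IsEquivalentNorm p) (u : StrongDual ℝ (StrongDual ℝ X))
    {f : StrongDual ℝ X} (hf : ∀ x, |f x| ≤ p x) : |u f| ≤ bidualNorm p u := by
  obtain ⟨C, hC, hCf⟩ := hp.exists_opNorm_le
  refine le_csSup ⟨‖u‖ * C, ?_⟩ ⟨f, (hp.dualNorm_le_one_iff f).2 hf, rfl⟩
  rintro t ⟨φ, hφ, rfl⟩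
  exact (u.le_opNorm φ).trans
    (mul_le_mul_of_nonneg_left (hCf φ ((hp.dualNorm_le_one_iff φ).1 hφ)) (norm_nonneg u))

theorem bidualNorm_le (hp : IsEquivalentNorm p) (u : StrongDual ℝ (StrongDual ℝ X)) {c : ℝ}
    (h : ∀ f : StrongDual ℝ X, (∀ x, |f x| ≤ p x) → |u f| ≤ c) : bidualNorm p u ≤ c := by
  refine csSup_le ⟨_, 0, (hp.dualNorm_le_one_iff 0).2 fun x => by simp, rfl⟩ ?_
  rintro t ⟨φ, hφ, rfl⟩
  exact h φ ((hp.dualNorm_le_one_iff φ).1 hφ)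

theorem bidualNorm_add_le (hp : IsEquivalentNorm p) (u v : StrongDual ℝ (StrongDual ℝ X)) :
    bidualNorm p (u + v) ≤ bidualNorm p u + bidualNorm p v :=
  hp.bidualNorm_le _ fun _ hf => (abs_add_le _ _).trans
    (add_le_add (hp.abs_le_bidualNorm u hf) (hp.abs_le_bidualNorm v hf))

theorem bidualNorm_neg (hp : IsEquivalentNorm p) (u : StrongDual ℝ (StrongDual ℝ X)) :
    bidualNorm p (-u) = bidualNorm p u := by
  have key : ∀ v, bidualNorm p (-v) ≤ bidualNorm p v := fun v => hp.bidualNorm_le _ fun f hf => by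
    rw [_root_.neg_apply, abs_neg]
    exact hp.abs_le_bidualNorm v hf
  exact le_antisymm (key u) ((congrArg (bidualNorm p) (neg_neg u)).symm.le.trans (key (-u)))

theorem bidualNorm_sub_le (hp : IsEquivalentNorm p) (u v : StrongDual ℝ (StrongDual ℝ X)) :
    bidualNorm p u - bidualNorm p v ≤ bidualNorm p (u + v) := by
  have h := hp.bidualNorm_add_le (u + v) (-v)
  rw [hp.bidualNorm_neg, (add_neg_cancel_right u v : u + v + -v = u)] at h
  linarith

theorem bidualNorm_isEquivalent (hp : IsEquivalentNorm p) :
    ∃ c C : ℝ, 0 < c ∧ 0 < C ∧ ∀ u : StrongDual ℝ (StrongDual ℝ X),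
      c * ‖u‖ ≤ bidualNorm p u ∧ bidualNorm p u ≤ C * ‖u‖ := by
  obtain ⟨C, hC, hCf⟩ := hp.exists_opNorm_le
  have hp' := hp
  obtain ⟨c, D, hc, hD, h⟩ := hp'
  refine ⟨c, C, hc, hC, fun u => ⟨?_, hp.bidualNorm_le u fun f hf => ?_⟩⟩
  · rw [← le_inv_mul_iff₀ hc]
    have hq : 0 ≤ bidualNorm p u :=
      (abs_nonneg _).trans (hp.abs_le_bidualNorm u (f := 0) fun x => by simp)
    refine u.opNorm_le_of_unit_norm (by positivity) fun f hf => ?_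
    rw [le_inv_mul_iff₀ hc, ← abs_of_pos hc, Real.norm_eq_abs, ← abs_mul, ← smul_eq_mul,
      ← map_smul]
    refine hp.abs_le_bidualNorm u fun x => ?_
    rw [_root_.smul_apply, smul_eq_mul, abs_mul, abs_of_pos hc]
    refine le_trans (mul_le_mul_of_nonneg_left ?_ hc.le) (h x).1
    simpa [hf] using f.le_opNorm x
  · rw [mul_comm]
    exact (u.le_opNorm f).trans (mul_le_mul_of_nonneg_left (hCf f hf) (norm_nonneg u))

end IsEquivalentNorm

/-- A function equivalent to the norm is octahedral once there is a sequence of unit vectors that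
is asymptotically additive to every single vector. -/
theorem isOctahedral_of_sequence {E : Type*} [NormedAddCommGroup E] [NormedSpace ℝ E] {q : E → ℝ}
    (hadd : ∀ u v, q (u + v) ≤ q u + q v) (hsub : ∀ u v, q u - q v ≤ q (u + v))
    {c C : ℝ} (hc : 0 < c) (hC : 0 < C) (hq : ∀ u, c * ‖u‖ ≤ q u ∧ q u ≤ C * ‖u‖)
    {y : ℕ → E} (hy : ∀ n, q (y n) = 1)
    (hlim : ∀ u, ∀ δ > 0, ∀ᶠ n in Filter.atTop, q u + 1 - δ ≤ q (u + y n)) :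
    IsOctahedral q := by
  intro F hF ε hε
  obtain ⟨δ, hδ, hδε⟩ : ∃ δ : ℝ, 0 < δ ∧ 3 * δ ≤ ε := ⟨ε / 3, by positivity, by linarith⟩
  have hcomp : IsCompact (Metric.closedBall (0 : F) (2 / ε / c)) := isCompact_closedBall _ _
  obtain ⟨t, htfin, ht⟩ := Metric.totallyBounded_iff.1 hcomp.totallyBounded (δ / C)
    (by positivity)
  have hev : ∀ᶠ n in Filter.atTop, ∀ v ∈ t, q v + 1 - δ ≤ q (v + y n) :=
    (Filter.eventually_all_finite htfin).2 fun v _ => hlim v δ hδ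
  obtain ⟨n, hn⟩ := hev.exists
  refine ⟨y n, hy n, fun x hx => ?_⟩
  rw [hy]
  have hq0 : 0 ≤ q x := le_trans (by positivity) (hq x).1
  -- For large `x` the triangle inequality suffices. The remaining `x` lie in a compact ball, and a
  -- finite net reduces them to finitely many vectors at a cost of `3 * δ`.
  rcases le_or_gt (2 / ε) (q x) with hbig | hsmall
  · have h1 := hsub x (y n)
    rw [hy] at h1
    rw [div_le_iff₀ hε] at hbig
    nlinarith
  · have hmem : (⟨x, hx⟩ : F) ∈ Metric.closedBall (0 : F) (2 / ε / c) := by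
      rw [mem_closedBall_zero_iff, le_div_iff₀' hc]
      exact (hq x).1.trans hsmall.le
    obtain ⟨v, hv, hxv⟩ := Set.mem_iUnion₂.1 (ht hmem)
    have hd : ‖x - v‖ < δ / C := by
      rw [Metric.mem_ball, dist_eq_norm] at hxv
      exact hxv
    rw [lt_div_iff₀' hC] at hd
    have h0 : q (x - v) ≤ δ := (hq _).2.trans hd.le
    have h1 : q x ≤ q v + q (x - v) := by simpa using hadd (v : E) (x - v)
    have h2 : q (v + y n) - q (x - v) ≤ q (x + y n) := by
      have := hsub ((v : E) + y n) (x - v)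
      rwa [show (v : E) + y n + (x - v) = x + y n by abel] at this
    have h3 := hn v hv
    nlinarith

theorem IsEquivalentNorm.exists_le_apply (hp : IsEquivalentNorm p)
    (u : StrongDual ℝ (StrongDual ℝ X)) {δ : ℝ} (hδ : 0 < δ) :
    ∃ f : StrongDual ℝ X, (∀ x, |f x| ≤ p x) ∧ bidualNorm p u - δ ≤ u f := by
  by_contra! hcon
  have h1 : bidualNorm p u ≤ bidualNorm p u - δ := hp.bidualNorm_le u fun f hf => by
    refine abs_le'.2 ⟨(hcon f hf).le, ?_⟩
    have h2 := hcon (-f) fun x => by rw [_root_.neg_apply, abs_neg]; exact hf x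
    rw [map_neg] at h2
    exact h2.le
  linarith

theorem IsEquivalentNorm.isOctahedral_bidualNorm (hp : IsEquivalentNorm p)
    {y : ℕ → StrongDual ℝ (StrongDual ℝ X)} (hy : ∀ n, bidualNorm p (y n) = 1)
    (hlim : ∀ u, ∀ δ > 0, ∀ᶠ n in Filter.atTop,
      bidualNorm p u + 1 - δ ≤ bidualNorm p (u + y n)) : IsOctahedral (bidualNorm p) := by
  obtain ⟨c, C, hc, hC, hq⟩ := hp.bidualNorm_isEquivalent
  have h := isOctahedral_of_sequence (E := StrongDual ℝ (StrongDual ℝ X)) (q := bidualNorm p)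
    hp.bidualNorm_add_le hp.bidualNorm_sub_le hc hC hq hy hlim
  exact h

theorem hasBidualOctahedralRenorming_of_containsEllOne (hX : ContainsEllOne X) :
    HasBidualOctahedralRenorming X := by
  obtain ⟨p, y, hp, hy, hφ⟩ := exists_norm_with_asymptotic_directions hX
  obtain ⟨z, hz⟩ : ∃ z : ℕ → StrongDual ℝ (StrongDual ℝ X), ∀ n f, z n f = f (y n) :=
    ⟨fun n => NormedSpace.inclusionInDoubleDual ℝ X (y n), fun n f => NormedSpace.dual_def ..⟩
  refine ⟨p, hp, hp.isOctahedral_bidualNorm (y := z) (fun n => ?_) fun u δ hδ => ?_⟩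
  · refine le_antisymm (hp.bidualNorm_le _ fun f hf => ?_) ?_
    · rw [hz]
      exact (hf _).trans (hy n)
    · obtain ⟨φ, hφp, hφy, -⟩ := hφ 0 fun x => by simp
      have h1 := (le_abs_self _).trans (hp.abs_le_bidualNorm (z n) (hφp n))
      rwa [hz, hφy] at h1
  · obtain ⟨f, hf, hfu⟩ := hp.exists_le_apply u (half_pos hδ)
    obtain ⟨φ, hφp, hφy, hlim⟩ := hφ f hf
    filter_upwards [hlim u (δ / 2) (half_pos hδ)] with n hn
    have h1 := (le_abs_self _).trans (hp.abs_le_bidualNorm (u + z n) (hφp n))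
    have h2 : (u + z n) (φ n) = u (φ n) + z n (φ n) := rfl
    rw [h2, hz, hφy] at h1
    linarith

end BidualNorm

/-! ### Separable saturation and complementation. -/

variable {X : Type*} [NormedAddCommGroup X] [NormedSpace ℝ X]

/-- On finitely many functionals, the points of a set are approximated by those of a countable
subset. -/
theorem exists_countable_approx (W : Set X) (G : Finset (StrongDual ℝ X)) :
    ∃ D ⊆ W, D.Countable ∧ ∀ x ∈ W, ∀ δ > 0, ∃ d ∈ D, ∀ f ∈ G, |f d - f x| < δ := by
  let Φ : X → (G → ℝ) := fun x f => (f : StrongDual ℝ X) x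
  -- `W` need not be separable, but its image in the finite-dimensional space `G → ℝ` is.
  obtain ⟨t, hts, htc, hst⟩ := (TopologicalSpace.IsSeparable.of_separableSpace
    (Φ '' W)).exists_countable_dense_subset
  have ht : ∀ b ∈ t, ∃ x, x ∈ W ∧ Φ x = b := fun b hb => hts hb
  choose! r hrW hrΦ using ht
  refine ⟨r '' t, Set.image_subset_iff.2 hrW, htc.image r, fun x hx δ hδ => ?_⟩
  obtain ⟨b, hb, hxb⟩ := Metric.mem_closure_iff.1 (hst ⟨x, hx, rfl⟩) δ hδ
  refine ⟨r b, ⟨b, hb, rfl⟩, fun f hf => ?_⟩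
  rw [← hrΦ b hb, dist_comm] at hxb
  exact (dist_le_pi_dist (Φ (r b)) (Φ x) ⟨f, hf⟩).trans_lt hxb

/-- A separable subspace is almost normed by countably many functionals. -/
theorem exists_countable_norming {Z : Set X} (hZ : TopologicalSpace.IsSeparable Z) :
    ∃ B : Set (StrongDual ℝ X), B.Countable ∧
      ∀ z ∈ Z, ∀ δ > 0, ∃ f ∈ B, ‖f‖ ≤ 1 ∧ ‖z‖ - δ ≤ f z := by
  obtain ⟨t, -, htc, hst⟩ := hZ.exists_countable_dense_subset
  choose f hf1 hfx using fun x : X => exists_dual_vector'' ℝ x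
  refine ⟨f '' t, htc.image f, fun z hz δ hδ => ?_⟩
  obtain ⟨d, hd, hzd⟩ := Metric.mem_closure_iff.1 (hst hz) (δ / 2) (half_pos hδ)
  refine ⟨f d, ⟨d, hd, rfl⟩, hf1 d, ?_⟩
  have h1 : f d d = ‖d‖ := hfx d
  have h2 : |f d (z - d)| ≤ ‖z - d‖ :=
    ((f d).le_opNorm _).trans (mul_le_of_le_one_left (norm_nonneg _) (hf1 d))
  rw [map_sub, h1] at h2
  rw [dist_eq_norm] at hzd
  have h3 : ‖z‖ ≤ ‖z - d‖ + ‖d‖ := by simpa using norm_add_le (z - d) d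
  linarith [(abs_le.1 h2).1]

/-- One step of the saturation of a pair of a separable subspace and a countable set of
functionals. -/
theorem exists_saturation_step {J : Type*} [Countable J] (W : J → Set X) (Z : Submodule ℝ X)
    (B : Set (StrongDual ℝ X)) (hZ : TopologicalSpace.IsSeparable (Z : Set X))
    (hB : B.Countable) :
    ∃ (Z' : Submodule ℝ X) (B' : Set (StrongDual ℝ X)),
      (TopologicalSpace.IsSeparable (Z' : Set X) ∧ B'.Countable) ∧ Z ≤ Z' ∧ B ⊆ B' ∧
      (∀ z ∈ Z, ∀ δ > 0, ∃ f ∈ B', ‖f‖ ≤ 1 ∧ ‖z‖ - δ ≤ f z) ∧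
      ∀ (j : J) (G : Finset (StrongDual ℝ X)), (G : Set (StrongDual ℝ X)) ⊆ B →
        ∀ x ∈ W j, ∀ δ > 0, ∃ z ∈ Z', z ∈ W j ∧ ∀ f ∈ G, |f z - f x| < δ := by
  obtain ⟨N, hNc, hN⟩ := exists_countable_norming hZ
  choose D hDW hDc hD using fun j G => exists_countable_approx (W j) G
  have hGc : {G : Finset (StrongDual ℝ X) | (G : Set (StrongDual ℝ X)) ⊆ B}.Countable := by
    refine Set.MapsTo.countable_of_injOn (f := fun G => (G : Set (StrongDual ℝ X)))
      (t := {t | t.Finite ∧ t ⊆ B}) (fun G hG => ⟨G.finite_toSet, hG⟩)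
      Finset.coe_injective.injOn (Set.countable_ofPred_finite_subset hB)
  set A : Set X := ⋃ j, ⋃ G ∈ {G : Finset (StrongDual ℝ X) | (G : Set (StrongDual ℝ X)) ⊆ B}, D j G
    with hA
  have hAc : A.Countable := Set.countable_iUnion fun j => hGc.biUnion fun G _ => hDc j G
  refine ⟨Submodule.span ℝ (Z ∪ A), B ∪ N, ⟨(hZ.union hAc.isSeparable).span, hB.union hNc⟩,
    fun z hz => Submodule.subset_span (Or.inl hz), Set.subset_union_left, fun z hz δ hδ => ?_,
    fun j G hG x hx δ hδ => ?_⟩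
  · obtain ⟨f, hf, hfz⟩ := hN z hz δ hδ
    exact ⟨f, Or.inr hf, hfz⟩
  · obtain ⟨d, hd, hdx⟩ := hD j G x hx δ hδ
    refine ⟨d, Submodule.subset_span (Or.inr ?_), hDW j G hd, hdx⟩
    exact Set.mem_iUnion.2 ⟨j, Set.mem_biUnion (show G ∈ _ from hG) hd⟩

/-- Every separable subspace lies in a separable one that is saturated, with respect to countably
many sets and to a set of functionals by which it is normed. -/
theorem exists_saturated {J : Type*} [Countable J] (W : J → Set X) (Y : Submodule ℝ X)
    (hY : TopologicalSpace.IsSeparable (Y : Set X)) :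
    ∃ (Z : Submodule ℝ X) (B : Set (StrongDual ℝ X)),
      TopologicalSpace.IsSeparable (Z : Set X) ∧ Y ≤ Z ∧
      (∀ z ∈ Z, (∀ f ∈ B, f z = 0) → z = 0) ∧ IsClosed (Z : Set X) ∧
      ∀ (j : J) (G : Finset (StrongDual ℝ X)), (G : Set (StrongDual ℝ X)) ⊆ B →
        ∀ x ∈ W j, ∀ δ > 0, ∃ z ∈ Z, z ∈ W j ∧ ∀ f ∈ G, |f z - f x| < δ := by
  let S := {q : Submodule ℝ X × Set (StrongDual ℝ X) //
    TopologicalSpace.IsSeparable (q.1 : Set X) ∧ q.2.Countable}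
  have hstep : ∀ q : S, ∃ r : S, q.1.1 ≤ r.1.1 ∧ q.1.2 ⊆ r.1.2 ∧
      (∀ z ∈ q.1.1, ∀ δ > 0, ∃ f ∈ r.1.2, ‖f‖ ≤ 1 ∧ ‖z‖ - δ ≤ f z) ∧
      ∀ (j : J) (G : Finset (StrongDual ℝ X)), (G : Set (StrongDual ℝ X)) ⊆ q.1.2 →
        ∀ x ∈ W j, ∀ δ > 0, ∃ z ∈ r.1.1, z ∈ W j ∧ ∀ f ∈ G, |f z - f x| < δ := by
    rintro ⟨⟨Z, B⟩, hZ, hB⟩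
    obtain ⟨Z', B', h, h'⟩ := exists_saturation_step W Z B hZ hB
    exact ⟨⟨⟨Z', B'⟩, h⟩, h'⟩
  choose next hZle hBle hnorm happ using hstep
  let s : ℕ → S := fun n => next^[n] ⟨⟨Y, ∅⟩, hY, Set.countable_empty⟩
  have hs : ∀ n, s (n + 1) = next (s n) := fun n => Function.iterate_succ_apply' _ _ _
  have hZmono : Monotone fun n => (s n).1.1 :=
    monotone_nat_of_le_succ fun n => by rw [hs]; exact hZle _
  have hBmono : Monotone fun n => (s n).1.2 :=
    monotone_nat_of_le_succ fun n => by rw [hs]; exact hBle _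
  have hmem : ∀ z, z ∈ ⨆ n, (s n).1.1 ↔ ∃ n, z ∈ (s n).1.1 := fun z =>
    Submodule.mem_iSup_of_directed _ hZmono.directed_le
  have hle : (⨆ n, (s n).1.1) ≤ (⨆ n, (s n).1.1).topologicalClosure :=
    Submodule.le_topologicalClosure _
  refine ⟨(⨆ n, (s n).1.1).topologicalClosure, ⋃ n, (s n).1.2, ?_, ?_, fun z hz hfz => ?_,
    Submodule.isClosed_topologicalClosure _, fun j G hG x hx δ hδ => ?_⟩
  · rw [Submodule.topologicalClosure_coe, TopologicalSpace.isSeparable_closure]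
    have : ((⨆ n, (s n).1.1 : Submodule ℝ X) : Set X) = ⋃ n, ((s n).1.1 : Set X) := by
      ext z
      simp only [SetLike.mem_coe, hmem, Set.mem_iUnion]
    rw [this]
    exact .iUnion fun n => (s n).2.1
  · exact (le_iSup (fun n => (s n).1.1) 0).trans hle
  · refine norm_le_zero_iff.1 (le_of_forall_pos_le_add fun δ hδ => ?_)
    obtain ⟨d, hd, hzd⟩ := Metric.mem_closure_iff.1 hz (δ / 4) (by positivity)
    obtain ⟨n, hn⟩ := (hmem d).1 hd
    obtain ⟨f, hf, hf1, hfd⟩ := hnorm (s n) d hn (δ / 4) (by positivity)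
    rw [← hs] at hf
    have h1 := hfz f (Set.mem_iUnion.2 ⟨n + 1, hf⟩)
    have h2 : |f (z - d)| ≤ ‖z - d‖ :=
      (f.le_opNorm _).trans (mul_le_of_le_one_left (norm_nonneg _) hf1)
    rw [map_sub, h1] at h2
    rw [dist_eq_norm] at hzd
    have h3 : ‖z‖ ≤ ‖z - d‖ + ‖d‖ := by simpa using norm_add_le (z - d) d
    linarith [(abs_le.1 h2).1]
  · have hG' : ∀ f ∈ G, ∃ n, f ∈ (s n).1.2 := fun f hf => Set.mem_iUnion.1 (hG hf)
    choose! n hn using hG'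
    -- A finite set of functionals from the increasing union already occurs at one stage.
    obtain ⟨z, hz, hzW, hzx⟩ := happ (s (G.sup n)) j G
      (fun f hf => hBmono (Finset.le_sup hf) (hn f hf)) x hx δ hδ
    rw [← hs] at hz
    exact ⟨z, hle ((hmem z).2 ⟨_, hz⟩), hzW, hzx⟩


/-- Let countably many weak-star compact subsets of the bidual cover `X`, and separate `X` from its
complement in the bidual. Then `X` has the separable complementation property. -/
theorem separableComplementation_of_separating [CompleteSpace X] {I : Type*} [Countable I]
    (K : I → Set (WeakDual ℝ (StrongDual ℝ X))) (hK : ∀ i, IsCompact (K i))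
    (hcover : ∀ x : X, ∃ i,
      StrongDual.toWeakDual (NormedSpace.inclusionInDoubleDual ℝ X x) ∈ K i)
    (hsep : ∀ (x : X) (u : StrongDual ℝ (StrongDual ℝ X)),
      u ∉ Set.range (NormedSpace.inclusionInDoubleDual ℝ X) →
      ∃ i, StrongDual.toWeakDual (NormedSpace.inclusionInDoubleDual ℝ X x) ∈ K i ∧
        StrongDual.toWeakDual u ∉ K i) : SeparableComplementation X := by
  classical
  intro Y hY
  let ι : X → WeakDual ℝ (StrongDual ℝ X) :=
    fun x => StrongDual.toWeakDual (NormedSpace.inclusionInDoubleDual ℝ X x)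
  have hι : ∀ x f, ι x f = f x := fun x f => rfl
  obtain ⟨Z, B, hZs, hYZ, hinj, hZc, happ⟩ :=
    exists_saturated (fun σ : Finset I => {x : X | ∀ i ∈ σ, ι x ∈ K i}) Y hY
  refine ⟨Z, hZs, ?_, hYZ⟩
  let Q : Submodule ℝ X := ⨅ f ∈ B, LinearMap.ker (f : X →ₗ[ℝ] ℝ)
  have hQ : ∀ z, z ∈ Q ↔ ∀ f ∈ B, f z = 0 := fun z => by simp [Q, Submodule.mem_iInf]
  have hQc : IsClosed (Q : Set X) := by
    have : (Q : Set X) = ⋂ f ∈ B, {z | f z = 0} := by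
      ext z
      simp [hQ]
    rw [this]
    exact isClosed_biInter fun f _ => isClosed_eq f.continuous continuous_const
  refine Submodule.ClosedComplemented.of_isCompl_isClosed (q := Q) ⟨?_, ?_⟩ hZc hQc
  · rw [Submodule.disjoint_def]
    exact fun z hz hzQ => hinj z hz ((hQ z).1 hzQ)
  rw [codisjoint_iff, eq_top_iff]
  rintro x -
  suffices h : ∃ w ∈ Z, ∀ f ∈ B, f w = f x by
    obtain ⟨w, hw, hwx⟩ := h
    refine Submodule.mem_sup.2 ⟨w, hw, x - w, (hQ _).2 fun f hf => ?_, add_sub_cancel w x⟩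
    rw [map_sub, hwx f hf, sub_self]
  have happ' : ∀ k : Finset I × Finset (StrongDual ℝ X) × ℕ, ∃ z ∈ Z,
      (∀ i ∈ k.1, ι x ∈ K i → ι z ∈ K i) ∧
      ∀ f ∈ k.2.1, f ∈ B → |f z - f x| < 1 / ((k.2.2 : ℝ) + 1) := by
    rintro ⟨σ, G, m⟩
    obtain ⟨z, hz, hzK, hzf⟩ := happ (σ.filter fun i => ι x ∈ K i) (G.filter fun f => f ∈ B)
      (fun f hf => (Finset.mem_filter.1 hf).2) x (fun i hi => (Finset.mem_filter.1 hi).2)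
      (1 / ((m : ℝ) + 1)) (by positivity)
    exact ⟨z, hz, fun i hi hx => hzK i (Finset.mem_filter.2 ⟨hi, hx⟩),
      fun f hf hfB => hzf f (Finset.mem_filter.2 ⟨hf, hfB⟩)⟩
  choose z hzZ hzK hzf using happ'
  -- One limit must serve all `K i` containing `x` and all functionals at once, hence an ultrafilter
  -- on the index set of finite data.
  let U : Ultrafilter (Finset I × Finset (StrongDual ℝ X) × ℕ) := Ultrafilter.of Filter.atTop
  have hU : (U : Filter (Finset I × Finset (StrongDual ℝ X) × ℕ)) ≤ Filter.atTop :=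
    Ultrafilter.of_le Filter.atTop
  have hev : ∀ i, ι x ∈ K i → ∀ᶠ k in (U : Filter _), ι (z k) ∈ K i := fun i hi => by
    refine hU ?_
    filter_upwards [Filter.eventually_ge_atTop
      (({i}, ∅, 0) : Finset I × Finset (StrongDual ℝ X) × ℕ)] with k hk
    exact hzK k i (hk.1 (Finset.mem_singleton_self i)) hi
  obtain ⟨i₀, hi₀⟩ := hcover x
  obtain ⟨v, -, hv⟩ := (hK i₀).ultrafilter_le_nhds' (U.map fun k => ι (z k)) (hev i₀ hi₀)
  have hvt : Filter.Tendsto (fun k => ι (z k)) U (nhds v) := hv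
  have hvK : ∀ i, ι x ∈ K i → v ∈ K i := fun i hi =>
    (hK i).isClosed.mem_of_tendsto hvt (hev i hi)
  obtain ⟨w, hw⟩ : WeakDual.toStrongDual v ∈ Set.range (NormedSpace.inclusionInDoubleDual ℝ X) := by
    by_contra hcon
    obtain ⟨i, hi, hvi⟩ := hsep x _ hcon
    exact hvi (hvK i hi)
  have hlim : ∀ f : StrongDual ℝ X, Filter.Tendsto (fun k => f (z k)) U (nhds (f w)) := by
    intro f
    have h1 : f w = v f := by
      rw [← NormedSpace.dual_def ℝ X w f, hw]
      rfl
    rw [h1]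
    exact ((WeakDual.eval_continuous f).tendsto v).comp hvt
  refine ⟨w, ?_, fun f hf => tendsto_nhds_unique (hlim f) ?_⟩
  -- The approximants converge weakly to `w`, and a closed subspace is weakly closed.
  · by_contra hwZ
    obtain ⟨f, s, hfs, hsf⟩ := geometric_hahn_banach_point_closed Z.convex hZc hwZ
    have := ge_of_tendsto (hlim f) (Filter.Eventually.of_forall fun k => (hsf _ (hzZ k)).le)
    linarith
  · refine Metric.tendsto_nhds.2 fun δ hδ => ?_
    obtain ⟨m, hm⟩ := exists_nat_one_div_lt hδ
    refine hU ?_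
    filter_upwards [Filter.eventually_ge_atTop
      ((∅, {f}, m) : Finset I × Finset (StrongDual ℝ X) × ℕ)] with k hk
    rw [Real.dist_eq]
    refine (hzf k f (hk.2.1 (Finset.mem_singleton_self f)) hf).trans (lt_of_le_of_lt ?_ hm)
    have h1 : (m : ℝ) ≤ k.2.2 := by exact_mod_cast hk.2.2
    exact one_div_le_one_div_of_le (by positivity) (by linarith)

theorem WeaklyCountablyDetermined.separableComplementation [CompleteSpace X]
    (h : WeaklyCountablyDetermined X) : SeparableComplementation X := by
  obtain ⟨K, hK, hsep⟩ := h
  refine separableComplementation_of_separating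
    -- The balls make the sets cover `X`; if `X` is reflexive, the separation property says nothing
    -- about `K`.
    (Sum.elim K fun m : ℕ => WeakDual.toStrongDual ⁻¹' Metric.closedBall 0 m) ?_ (fun x => ?_)
    fun x u hu => ?_
  · rintro (n | m)
    · exact hK n
    · exact WeakDual.isCompact_closedBall 0 m
  · obtain ⟨m, hm⟩ := exists_nat_ge ‖x‖
    refine ⟨Sum.inr m, ?_⟩
    have hmem : NormedSpace.inclusionInDoubleDual ℝ X x ∈
        Metric.closedBall (0 : StrongDual ℝ (StrongDual ℝ X)) m :=
      (mem_closedBall_zero_iff (E := StrongDual ℝ (StrongDual ℝ X))).2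
        ((NormedSpace.double_dual_bound ℝ X x).trans hm)
    exact hmem
  · obtain ⟨n, hn⟩ := hsep x u hu
    exact ⟨Sum.inl n, hn⟩

end BidualOctahedral

end

theorem corollary4p3 (X : Type*) [NormedAddCommGroup X] [NormedSpace ℝ X] [CompleteSpace X] :
    (BidualOctahedral.SeparableComplementation X → BidualOctahedral.ContainsEllOne X →
      BidualOctahedral.HasBidualOctahedralRenorming X) ∧
    (BidualOctahedral.WeaklyCountablyDetermined X →
      BidualOctahedral.SeparableComplementation X) ∧
    (BidualOctahedral.WeaklyCountablyDetermined X → BidualOctahedral.ContainsEllOne X →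
      BidualOctahedral.HasBidualOctahedralRenorming X) :=
  ⟨fun _ h => BidualOctahedral.hasBidualOctahedralRenorming_of_containsEllOne h,
    fun h => h.separableComplementation,
    fun _ h => BidualOctahedral.hasBidualOctahedralRenorming_of_containsEllOne h⟩
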